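/- Let $d\ge 1$ and $0\le m\le d$ be integers, and let $C=\mathbb R_+^m\times\mathbb R^{d-m}=\{x\in\mathbb R^d: x_1,\dots,x_m>0\}$. All derivatives are understood in the sense of distributions on $C$, and $\|\cdot\|_\infty$ denotes the norm of $L_\infty(C)$ (with respect to Lebesgue measure). For a locally integrable function $f$ on $C$ put $\partial_{\mathbf I}f=\dfrac{\partial^d f}{\partial x_1\cdots\partial x_d}$, and for a function $g$ on $C$ with locally integrable first-order partial derivatives put $|\nabla g|_1=\sum_{i=1}^d\left|\dfrac{\partial g}{\partial x_i}\right|$. Let $W^{1,\infty}(C)$ be the space of functions $g\in L_\infty(C)$ all of whose first-order partial derivatives belong to $L_\infty(C)$. Let $f\in L_\infty(C)$ be such that $\partial_{\mathbf I}f\in W^{1,\infty}(C)$. Then $\partial_{\mathbf I}f$ and $|\nabla\partial_{\mathbf I}f|_1$ belong to $L_\infty(C)$, and the following inequalities hold. 1. (Additive form) For every $h>0$, $$\|\partial_{\mathbf I}f\|_\infty\le h\,\frac{d}{d+1}\,\bigl\||\nabla\partial_{\mathbf I}f|_1\bigr\|_\infty+\frac{2^m}{h^d}\,\|f\|_\infty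 .$$ 2. (Multiplicative form) $$\|\partial_{\mathbf I}f\|_\infty\le\bigl(2^m(d+1)\|f\|_\infty\bigr)^{\frac1{d+1}}\,\bigl\||\nabla\partial_{\mathbf I}f|_1\bigr\|_\infty^{\frac d{d+1}} .$$ For $m=0$ and $m=1$ both inequalities are sharp: for every $h>0$ there is a function $f\in L_\infty(C)$ with $\partial_{\mathbf I}f\in W^{1,\infty}(C)$ and $\|\partial_{\mathbf I}f\|_\infty>0$ for which the additive inequality with this $h$ and the multiplicative inequality are both equalities. -/

import Mathlib

open MeasureTheory TopologicalSpace
open scoped Distributions LineDeriv ENNReal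

noncomputable section

namespace MixedDeriv

/-- The open cone `ℝ₊^m × ℝ^{d-m}`: the first `m` coordinates are strictly positive. -/
def cone (d m : ℕ) : Opens (Fin d → ℝ) where
  carrier := {x | ∀ i : Fin d, (i : ℕ) < m → 0 < x i}
  is_open' := by
    simp only [Set.ofPred_forall]
    refine isOpen_iInter_of_finite fun i => isOpen_iInter_of_finite fun _ => ?_
    exact isOpen_lt continuous_const (continuous_apply i)

/-- The `i`-th standard basis vector of `ℝ^d`. -/
def basisVec {d : ℕ} (i : Fin d) : Fin d → ℝ := Pi.single i 1

/-- Lebesgue measure on the open set `Ω`. -/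
def leb {d : ℕ} (Ω : Opens (Fin d → ℝ)) : Measure (Fin d → ℝ) :=
  volume.restrict (Ω : Set (Fin d → ℝ))

/-- `f ∈ L_∞(Ω)`. -/
def MemLinf {d : ℕ} (Ω : Opens (Fin d → ℝ)) (f : (Fin d → ℝ) → ℝ) : Prop :=
  MemLp f ∞ (leb Ω)

/-- The norm of `L_∞(Ω)`, i.e. the essential supremum of `|f|` over `Ω`. -/
def normLinf {d : ℕ} (Ω : Opens (Fin d → ℝ)) (f : (Fin d → ℝ) → ℝ) : ℝ :=
  lpNorm f ∞ (leb Ω)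

/-- The distributional partial derivative `∂g/∂xᵢ` on `Ω` of the locally integrable function `g`
is the locally integrable function `G`. Here `𝓓(Ω, ℝ)` is the space of smooth functions with
compact support contained in `Ω`. -/
def HasWeakPartial {d : ℕ} (Ω : Opens (Fin d → ℝ)) (i : Fin d) (g G : (Fin d → ℝ) → ℝ) : Prop :=
  LocallyIntegrableOn g (Ω : Set (Fin d → ℝ)) ∧ LocallyIntegrableOn G (Ω : Set (Fin d → ℝ)) ∧
    ∀ φ : 𝓓(Ω, ℝ), ∫ x, g x * (∂_{basisVec i} φ) x ∂(leb Ω) = -∫ x, G x * φ x ∂(leb Ω)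

/-- The distributional mixed derivative `∂ᵈf/∂x₁…∂x_d` on `Ω` of the locally integrable function
`f` is the locally integrable function `g`. -/
def HasWeakMixed {d : ℕ} (Ω : Opens (Fin d → ℝ)) (f g : (Fin d → ℝ) → ℝ) : Prop :=
  LocallyIntegrableOn f (Ω : Set (Fin d → ℝ)) ∧ LocallyIntegrableOn g (Ω : Set (Fin d → ℝ)) ∧
    ∀ φ : 𝓓(Ω, ℝ),
      ∫ x, f x * (∂^{fun i : Fin d => basisVec i} φ) x ∂(leb Ω)
        = (-1) ^ d * ∫ x, g x * φ x ∂(leb Ω)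

open Classical in
/-- The distributional derivative `∂g/∂xᵢ` as a function on `Ω` (unique up to null sets),
whenever that distribution is a locally integrable function. -/
def weakPartial {d : ℕ} (Ω : Opens (Fin d → ℝ)) (i : Fin d) (g : (Fin d → ℝ) → ℝ) :
    (Fin d → ℝ) → ℝ :=
  if h : ∃ G, HasWeakPartial Ω i g G then h.choose else 0

open Classical in
/-- The distributional mixed derivative `∂_I f = ∂ᵈf/∂x₁…∂x_d` as a function on `Ω` (unique up
to null sets), whenever that distribution is a locally integrable function. -/
def weakMixed {d : ℕ} (Ω : Opens (Fin d → ℝ)) (f : (Fin d → ℝ) → ℝ) : (Fin d → ℝ) → ℝ :=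
  if h : ∃ g, HasWeakMixed Ω f g then h.choose else 0

/-- `|∇g|₁ = ∑ᵢ |∂g/∂xᵢ|`, with distributional partial derivatives. -/
def gradNormOne {d : ℕ} (Ω : Opens (Fin d → ℝ)) (g : (Fin d → ℝ) → ℝ) : (Fin d → ℝ) → ℝ :=
  fun x => ∑ i : Fin d, |weakPartial Ω i g x|

/-- The Sobolev space `W^{1,∞}(Ω)`. -/
def MemW1inf {d : ℕ} (Ω : Opens (Fin d → ℝ)) (g : (Fin d → ℝ) → ℝ) : Prop :=
  MemLinf Ω g ∧ ∀ i : Fin d, ∃ G, HasWeakPartial Ω i g G ∧ MemLinf Ω G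

/-- The space of functions `f ∈ L_∞(Ω)` whose distributional mixed derivative `∂_I f` belongs to
`W^{1,∞}(Ω)`. -/
def MemMixed {d : ℕ} (Ω : Opens (Fin d → ℝ)) (f : (Fin d → ℝ) → ℝ) : Prop :=
  MemLinf Ω f ∧ ∃ g, HasWeakMixed Ω f g ∧ MemW1inf Ω g

end MixedDeriv

end

noncomputable section

namespace MixedDeriv

/-! ### Correlations of a function with a translated test function. -/

section Correlation

variable {d : ℕ} {Ω : Opens (Fin d → ℝ)}

/-! Write g for the mixed derivative of f, F and Γ for the norms of f and |∇g|₁, and ‖·‖ for the sup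
norm on ℝ^d. For a smooth g, compare g at a point with its mean over the translate of the box Q =
[0,r]^m × [-r,r]^(d-m), which keeps the point inside the cone. The integral of g over a box is an
alternating sum of 2^d corner values of f, so it is at most 2^d F. Moving by y changes g by at most
Γ‖y‖, by ℓ¹/ℓ^∞ duality. Since Q has volume 2^(d-m) r^d and ‖y‖ has mean r d/(d+1) over Q, the
additive inequality follows, and choosing r gives the multiplicative one.

For weak derivatives the argument is run on U(y) = ∫ g(x) φ(x - y) dx with φ a test function. For y
in the closed cone, φ(· - y) is again a test function, so derivatives may be passed between f, g and
φ. This bounds |∫ g φ| by a constant times the L¹ norm of φ (`abs_corr_zero_le`), and Lebesgue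
differentiation turns that into a sup bound (`ae_abs_le_of_forall_abs_corr_le`).

For equality, g should decay at the maximal rate, so take the tent g = (h - ‖x‖)₊, with norm h and
|∇g|₁ ≤ 1. Its primitive against the kernel ∏ ½ sign(xᵢ - yᵢ) is bounded by 2^(-d) ∫ g over the
cone, which is h^(d+1)/(2^m (d+1)). With these bounds both right-hand sides are at most h
(`exists_extremal`). -/

theorem lineDerivOp_testFunction_apply (φ : 𝓓(Ω, ℝ)) (v x : Fin d → ℝ) :
    (∂_{v} φ) x = fderiv ℝ φ x v := by
  rw [TestFunction.lineDerivOp_eq_lineDerivCLM (𝕜 := ℝ),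
    TestFunction.lineDerivCLM_apply_of_le (by simp)]
  exact ((φ.contDiff.differentiable (by simp)).differentiableAt).lineDeriv_eq_fderiv

/-- The translate `x ↦ φ (x - y)` of a test function on `Ω`, for `y` with `Ω + y ⊆ Ω`. -/
def translate (φ : 𝓓(Ω, ℝ)) (y : Fin d → ℝ) (hy : ∀ x ∈ Ω, x + y ∈ Ω) : 𝓓(Ω, ℝ) where
  toFun x := φ (x - y)
  contDiff' := φ.contDiff.comp (contDiff_id.sub contDiff_const)
  hasCompactSupport' := φ.hasCompactSupport.comp_homeomorph (Homeomorph.subRight y)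
  tsupport_subset' := by
    have := tsupport_comp_eq_preimage (φ : (Fin d → ℝ) → ℝ) (Homeomorph.subRight y)
    intro x hx
    have hx' : x ∈ tsupport ((φ : (Fin d → ℝ) → ℝ) ∘ Homeomorph.subRight y) := hx
    rw [this] at hx'
    have := hy _ (φ.tsupport_subset hx')
    simpa using this

theorem translate_apply (φ : 𝓓(Ω, ℝ)) (y : Fin d → ℝ) (hy : ∀ x ∈ Ω, x + y ∈ Ω)
    (x : Fin d → ℝ) : translate φ y hy x = φ (x - y) := rfl

theorem lineDerivOp_translate (φ : 𝓓(Ω, ℝ)) (y : Fin d → ℝ) (hy : ∀ x ∈ Ω, x + y ∈ Ω)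
    (v : Fin d → ℝ) : ∂_{v} (translate φ y hy) = translate (∂_{v} φ) y hy := by
  ext x
  rw [translate_apply, lineDerivOp_testFunction_apply, lineDerivOp_testFunction_apply]
  change fderiv ℝ (fun x => φ (x - y)) x v = _
  rw [fderiv_comp_sub]

theorem iteratedLineDerivOp_translate (φ : 𝓓(Ω, ℝ)) (y : Fin d → ℝ)
    (hy : ∀ x ∈ Ω, x + y ∈ Ω) {n : ℕ} (v : Fin n → Fin d → ℝ) :
    ∂^{v} (translate φ y hy) = translate (∂^{v} φ) y hy := by
  induction n with
  | zero => rfl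
  | succ n ih =>
    rw [LineDeriv.iteratedLineDerivOp_succ_left, LineDeriv.iteratedLineDerivOp_succ_left, ih,
      lineDerivOp_translate]

/-- The correlation `y ↦ ∫ f(x) φ(x - y) dx`. -/
def corr (f φ : (Fin d → ℝ) → ℝ) (y : Fin d → ℝ) : ℝ := ∫ x, f x * φ (x - y)

theorem corr_eq_convolution (f φ : (Fin d → ℝ) → ℝ) :
    corr f φ = convolution f (fun x => φ (-x)) (ContinuousLinearMap.mul ℝ ℝ) volume := by
  ext y
  simp [corr, convolution_def]

theorem hasCompactSupport_comp_neg {φ : (Fin d → ℝ) → ℝ} (hφ : HasCompactSupport φ) :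
    HasCompactSupport fun x => φ (-x) :=
  hφ.comp_homeomorph (Homeomorph.neg _)

theorem continuous_corr {f : (Fin d → ℝ) → ℝ} (hf : LocallyIntegrable f) (φ : 𝓓(Ω, ℝ)) :
    Continuous (corr f φ) := by
  rw [corr_eq_convolution]
  exact (hasCompactSupport_comp_neg φ.hasCompactSupport).continuous_convolution_right _ hf
    (φ.continuous.comp continuous_neg)

/-- The derivative falls on the smooth factor of a convolution, so no regularity of f is needed. The
minus sign comes from y entering as x - y. -/
theorem hasDerivAt_corr {f : (Fin d → ℝ) → ℝ} (hf : LocallyIntegrable f) (φ : 𝓓(Ω, ℝ))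
    (y v : Fin d → ℝ) (t : ℝ) :
    HasDerivAt (fun t : ℝ => corr f φ (y + t • v)) (-corr f ⇑(∂_{v} φ : 𝓓(Ω, ℝ)) (y + t • v)) t := by
  have hc := hasCompactSupport_comp_neg φ.hasCompactSupport
  have hs : ContDiff ℝ 1 fun x => φ (-x) :=
    (φ.contDiff.of_le (by simp)).comp contDiff_neg
  have h1 := hc.hasFDerivAt_convolution_right (ContinuousLinearMap.mul ℝ ℝ) hf hs (y + t • v)
  have h2 : HasDerivAt (fun t : ℝ => y + t • v) v t := by
    simpa using ((hasDerivAt_id t).smul_const v).const_add y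
  have h3 := h1.comp_hasDerivAt t h2
  rw [convolution_precompR_apply _ hf (hc.fderiv ℝ) (hs.continuous_fderiv one_ne_zero)] at h3
  have h4 : (fun a => fderiv ℝ (fun x => φ (-x)) a v) = fun a => -(∂_{v} φ) (-a) := by
    ext a
    rw [lineDerivOp_testFunction_apply]
    have h5 := ((φ.contDiff.differentiable (by simp)) (-a)).hasFDerivAt.comp a
      (hasFDerivAt_id a).fun_neg
    have h6 : fderiv ℝ (fun x => φ (-x)) a = _ := h5.fderiv
    rw [h6]
    simp
  rw [h4] at h3
  rw [corr_eq_convolution, corr_eq_convolution]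
  have h5 : convolution f (fun a => -(∂_{v} φ) (-a)) (ContinuousLinearMap.mul ℝ ℝ) volume =
      -convolution f (fun a => (∂_{v} φ) (-a)) (ContinuousLinearMap.mul ℝ ℝ) volume := by
    ext x
    simp only [convolution_def, Pi.neg_apply, ContinuousLinearMap.mul_apply', mul_neg,
      integral_neg]
  rw [h5] at h3
  exact h3

theorem abs_corr_le {f : (Fin d → ℝ) → ℝ} {F : ℝ}
    (hF : ∀ᵐ x, |f x| ≤ F) (φ : 𝓓(Ω, ℝ)) (y : Fin d → ℝ) :
    |corr f φ y| ≤ F * ∫ x, |φ x| := by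
  rw [← integral_sub_right_eq_self (fun x => |φ x|) y, ← integral_const_mul, ← Real.norm_eq_abs]
  refine norm_integral_le_of_norm_le ?_ ?_
  · refine Integrable.const_mul ?_ _
    exact ((φ.continuous.integrable_of_hasCompactSupport φ.hasCompactSupport).abs).comp_sub_right y
  · filter_upwards [hF] with x hx
    rw [norm_mul]
    exact mul_le_mul_of_nonneg_right hx (norm_nonneg _)

/-! ### Integrating a mixed derivative over a box. -/

theorem integral_fin_succ {n : ℕ} {H : (Fin (n + 1) → ℝ) → ℝ} (hH : Integrable H) :
    ∫ t, H t = ∫ t' : Fin n → ℝ, ∫ s : ℝ, H (Fin.cons s t') := by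
  have hp := (volume_preserving_piFinSuccAbove (fun _ : Fin (n + 1) => ℝ) 0).symm
  have hi := (hp.integrable_comp_emb (MeasurableEquiv.measurableEmbedding _)).2 hH
  rw [← hp.integral_comp', Measure.volume_eq_prod, integral_prod_symm]
  · simp only [MeasurableEquiv.piFinSuccAbove_symm_apply, Fin.insertNthEquiv, Equiv.coe_fn_mk,
      Fin.insertNth_zero]
    rfl
  · exact hi

theorem setIntegral_Icc_fin_succ {n : ℕ} {H : (Fin (n + 1) → ℝ) → ℝ} (hH : Continuous H)
    (a b : Fin (n + 1) → ℝ) :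
    ∫ t in Set.Icc a b, H t = ∫ t' in Set.Icc (Fin.tail a) (Fin.tail b),
      ∫ s in Set.Icc (a 0) (b 0), H (Fin.cons s t') := by
  classical
  rw [← integral_indicator measurableSet_Icc, integral_fin_succ,
    ← integral_indicator measurableSet_Icc]
  · refine integral_congr_ae (Filter.Eventually.of_forall fun t' => ?_)
    simp only [Set.indicator_apply, Set.mem_Icc]
    rw [← integral_indicator measurableSet_Icc]
    by_cases h : Fin.tail a ≤ t' ∧ t' ≤ Fin.tail b
    · rw [if_pos h]
      refine integral_congr_ae (Filter.Eventually.of_forall fun s => ?_)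
      have h' : (a ≤ (Fin.cons s t' : Fin (n + 1) → ℝ) ∧ (Fin.cons s t' : Fin (n + 1) → ℝ) ≤ b)
          ↔ (a 0 ≤ s ∧ s ≤ b 0) := by
        rw [Fin.le_cons, Fin.cons_le]
        tauto
      simp only [Set.indicator_apply, Set.mem_Icc, h']
    · rw [if_neg h]
      refine (integral_congr_ae (Filter.Eventually.of_forall fun s => ?_)).trans
        (integral_zero ℝ ℝ)
      have h' : ¬ (a ≤ (Fin.cons s t' : Fin (n + 1) → ℝ) ∧
          (Fin.cons s t' : Fin (n + 1) → ℝ) ≤ b) := by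
        rw [Fin.le_cons, Fin.cons_le]
        tauto
      simp only [h', if_false]
  · exact (hH.continuousOn.integrableOn_compact isCompact_Icc).integrable_indicator
      measurableSet_Icc

/-- Fundamental theorem of calculus in each variable in turn: every integration removes one
derivative and doubles the number of boundary terms. The 2^n corner values left at the end are
correlations of f with φ itself. -/
theorem abs_setIntegral_corr_iteratedLineDerivOp_le {f : (Fin d → ℝ) → ℝ}
    (hf : LocallyIntegrable f) {F : ℝ} (hF : ∀ᵐ x, |f x| ≤ F) {n : ℕ} (v : Fin n → Fin d → ℝ)
    (φ : 𝓓(Ω, ℝ)) (p : Fin d → ℝ) {a b : Fin n → ℝ} (hab : a ≤ b) :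
    |∫ t in Set.Icc a b, corr f ⇑(∂^{v} φ) (p + ∑ i, t i • v i)| ≤ 2 ^ n * (F * ∫ x, |φ x|) := by
  induction n generalizing p with
  | zero =>
    have : Set.Icc a b = Set.univ := by
      ext t; simp [Subsingleton.elim a t, Subsingleton.elim b t]
    simpa [this, integral_unique, measureReal_def, volume_pi] using abs_corr_le hF φ p
  | succ n ih =>
    have hab' : Fin.tail a ≤ Fin.tail b := fun i => hab i.succ
    have hcont : ∀ q : Fin d → ℝ, Continuous fun t : Fin n → ℝ =>
        corr f ⇑(∂^{Fin.tail v} φ) (q + ∑ i, t i • Fin.tail v i) := fun q =>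
      (continuous_corr hf _).comp (by fun_prop)
    have key : ∫ t in Set.Icc a b, corr f ⇑(∂^{v} φ) (p + ∑ i, t i • v i) =
        (∫ t in Set.Icc (Fin.tail a) (Fin.tail b),
          corr f ⇑(∂^{Fin.tail v} φ) ((p + a 0 • v 0) + ∑ i, t i • Fin.tail v i)) -
        ∫ t in Set.Icc (Fin.tail a) (Fin.tail b),
          corr f ⇑(∂^{Fin.tail v} φ) ((p + b 0 • v 0) + ∑ i, t i • Fin.tail v i) := by
      rw [setIntegral_Icc_fin_succ, ← integral_sub]
      · refine integral_congr_ae (Filter.Eventually.of_forall fun t => ?_)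
        simp only [Fin.sum_univ_succ, Fin.cons_zero, Fin.cons_succ]
        rw [LineDeriv.iteratedLineDerivOp_succ_left]
        rw [integral_Icc_eq_integral_Ioc, ← intervalIntegral.integral_of_le (hab 0)]
        have := intervalIntegral.integral_eq_sub_of_hasDerivAt (a := a 0) (b := b 0)
          (fun s _ => (hasDerivAt_corr hf (∂^{Fin.tail v} φ)
            (p + ∑ i, t i • Fin.tail v i) (v 0) s).neg) 
          (by
            simp only [neg_neg]
            exact ((continuous_corr hf _).comp (by fun_prop)).intervalIntegrable _ _)
        simp only [neg_neg] at this
        convert this using 1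
        · refine intervalIntegral.integral_congr fun s _ => ?_
          simp only [Fin.tail]
          congr 1
          abel
        · simp only [Fin.tail, Pi.neg_apply]
          rw [neg_sub_neg]
          congr 2 <;> abel
      · exact (hcont _).continuousOn.integrableOn_compact isCompact_Icc
      · exact (hcont _).continuousOn.integrableOn_compact isCompact_Icc
      · exact (continuous_corr hf _).comp (by fun_prop)
    rw [key]
    refine (abs_sub _ _).trans ?_
    have h1 := ih (Fin.tail v) (p + a 0 • v 0) hab'
    have h2 := ih (Fin.tail v) (p + b 0 • v 0) hab'
    rw [pow_succ]
    linarith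

end Correlation

/-! ### Weak derivatives tested against translates. -/

theorem add_mem_cone {d m : ℕ} {y : Fin d → ℝ} (hy : ∀ i : Fin d, (i : ℕ) < m → 0 ≤ y i) :
    ∀ x ∈ cone d m, x + y ∈ cone d m :=
  fun _ hx i hi => add_pos_of_pos_of_nonneg (hx i hi) (hy i hi)

section Corr

variable {d : ℕ} {Ω : Opens (Fin d → ℝ)}

theorem corr_indicator (f : (Fin d → ℝ) → ℝ) (φ : 𝓓(Ω, ℝ)) {y : Fin d → ℝ}
    (hy : ∀ x ∈ Ω, x + y ∈ Ω) :
    corr ((Ω : Set (Fin d → ℝ)).indicator f) φ y = ∫ x, f x * translate φ y hy x ∂(leb Ω) := by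
  rw [leb, ← integral_indicator Ω.isOpen.measurableSet, corr]
  refine integral_congr_ae (Filter.Eventually.of_forall fun x => ?_)
  simp only [Set.indicator_mul_left, translate_apply]

/-- The extension of g by zero may jump across the boundary of Ω. The condition on y keeps the
translated test function supported in Ω, so the jump is not seen. -/
theorem HasWeakPartial.corr_eq {i : Fin d} {g G : (Fin d → ℝ) → ℝ} (h : HasWeakPartial Ω i g G)
    (φ : 𝓓(Ω, ℝ)) {y : Fin d → ℝ} (hy : ∀ x ∈ Ω, x + y ∈ Ω) :
    corr ((Ω : Set (Fin d → ℝ)).indicator g) ⇑(∂_{basisVec i} φ : 𝓓(Ω, ℝ)) y =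
      -corr ((Ω : Set (Fin d → ℝ)).indicator G) φ y := by
  rw [corr_indicator _ _ hy, corr_indicator _ _ hy, ← h.2.2, lineDerivOp_translate]

theorem HasWeakMixed.corr_eq {f g : (Fin d → ℝ) → ℝ} (h : HasWeakMixed Ω f g)
    (φ : 𝓓(Ω, ℝ)) {y : Fin d → ℝ} (hy : ∀ x ∈ Ω, x + y ∈ Ω) :
    corr ((Ω : Set (Fin d → ℝ)).indicator f)
        ⇑(∂^{fun i : Fin d => basisVec i} φ : 𝓓(Ω, ℝ)) y =
      (-1) ^ d * corr ((Ω : Set (Fin d → ℝ)).indicator g) φ y := by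
  rw [corr_indicator _ _ hy, corr_indicator _ _ hy, ← h.2.2, iteratedLineDerivOp_translate]

theorem integrable_mul_testFunction_sub {f : (Fin d → ℝ) → ℝ} (hf : LocallyIntegrable f)
    (φ : 𝓓(Ω, ℝ)) (y : Fin d → ℝ) : Integrable fun x => f x * φ (x - y) := by
  have := hf.integrable_smul_left_of_hasCompactSupport (g := fun x => φ (x - y))
    (φ.continuous.comp (continuous_id.sub continuous_const))
    (φ.hasCompactSupport.comp_homeomorph (Homeomorph.subRight y))
  simpa [mul_comm] using this

theorem corr_lineDerivOp_eq_sum {f : (Fin d → ℝ) → ℝ} (hf : LocallyIntegrable f) (φ : 𝓓(Ω, ℝ))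
    (v y : Fin d → ℝ) :
    corr f ⇑(∂_{v} φ : 𝓓(Ω, ℝ)) y =
      ∑ i, v i * corr f ⇑(∂_{basisVec i} φ : 𝓓(Ω, ℝ)) y := by
  simp only [corr, ← integral_const_mul]
  rw [← integral_finsetSum _ fun i _ =>
    (integrable_mul_testFunction_sub hf (∂_{basisVec i} φ) y).const_mul _]
  refine integral_congr_ae (Filter.Eventually.of_forall fun x => ?_)
  simp only [lineDerivOp_testFunction_apply]
  have : v = ∑ i, v i • basisVec i := by
    simpa [basisVec] using pi_eq_sum_univ' v
  conv_lhs => rw [this]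
  simp only [map_sum, map_smul, smul_eq_mul, Finset.mul_sum]
  exact Finset.sum_congr rfl fun i _ => by ring

/-- Mean value inequality along the segment from 0 to y: the derivative at s • y is the correlation
of φ with ∑ yᵢ Gᵢ, and |∑ yᵢ Gᵢ| ≤ ‖y‖ ∑ |Gᵢ|. -/
theorem abs_corr_sub_corr_zero_le {g : (Fin d → ℝ) → ℝ} {G : Fin d → (Fin d → ℝ) → ℝ} {Γ : ℝ}
    (hg : LocallyIntegrable ((Ω : Set (Fin d → ℝ)).indicator g))
    (hG : ∀ i, LocallyIntegrable ((Ω : Set (Fin d → ℝ)).indicator (G i)))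
    (h : ∀ i, HasWeakPartial Ω i g (G i)) (hΓ0 : 0 ≤ Γ)
    (hΓ : ∀ᵐ x ∂(leb Ω), ∑ i, |G i x| ≤ Γ) (φ : 𝓓(Ω, ℝ)) {y : Fin d → ℝ}
    (hy : ∀ s : ℝ, 0 ≤ s → ∀ x ∈ Ω, x + s • y ∈ Ω) :
    |corr ((Ω : Set (Fin d → ℝ)).indicator g) φ y -
      corr ((Ω : Set (Fin d → ℝ)).indicator g) φ 0| ≤ Γ * ‖y‖ * ∫ x, |φ x| := by
  have hbound : ∀ᵐ x, |∑ i, y i * (Ω : Set (Fin d → ℝ)).indicator (G i) x| ≤ Γ * ‖y‖ := by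
    rw [leb, ae_restrict_iff' Ω.isOpen.measurableSet] at hΓ
    filter_upwards [hΓ] with x hx
    by_cases hxΩ : x ∈ (Ω : Set (Fin d → ℝ))
    · simp only [Set.indicator_of_mem hxΩ]
      refine (Finset.abs_sum_le_sum_abs _ _).trans ?_
      calc ∑ i, |y i * G i x| ≤ ∑ i, ‖y‖ * |G i x| := by
            refine Finset.sum_le_sum fun i _ => ?_
            rw [abs_mul]
            exact mul_le_mul_of_nonneg_right (norm_le_pi_norm y i) (abs_nonneg _)
        _ = ‖y‖ * ∑ i, |G i x| := by rw [Finset.mul_sum]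
        _ ≤ ‖y‖ * Γ := mul_le_mul_of_nonneg_left (hx hxΩ) (norm_nonneg _)
        _ = Γ * ‖y‖ := mul_comm _ _
    · simp only [Set.indicator_of_notMem hxΩ]
      simpa using mul_nonneg hΓ0 (norm_nonneg y)
  have hderiv : ∀ s : ℝ, 0 ≤ s →
      -corr ((Ω : Set (Fin d → ℝ)).indicator g) ⇑(∂_{y} φ : 𝓓(Ω, ℝ)) (0 + s • y) =
        corr (fun x => ∑ i, y i * (Ω : Set (Fin d → ℝ)).indicator (G i) x) φ (0 + s • y) := by
    intro s hs
    have hy' : ∀ x ∈ Ω, x + (0 + s • y) ∈ Ω := by simpa using hy s hs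
    rw [corr_lineDerivOp_eq_sum hg]
    simp only [(h _).corr_eq φ hy']
    simp only [mul_neg, Finset.sum_neg_distrib, neg_neg]
    simp only [corr, ← integral_const_mul]
    rw [← integral_finsetSum _ fun i _ =>
      (integrable_mul_testFunction_sub (hG i) φ _).const_mul _]
    refine integral_congr_ae (Filter.Eventually.of_forall fun x => ?_)
    simp only [Finset.sum_mul, mul_assoc]
  have := norm_image_sub_le_of_norm_deriv_le_segment_01'
    (f := fun s : ℝ => corr ((Ω : Set (Fin d → ℝ)).indicator g) φ (0 + s • y))
    (C := Γ * ‖y‖ * ∫ x, |φ x|)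
    (fun s _ => (hasDerivAt_corr hg φ 0 y s).hasDerivWithinAt) (fun s hs => by
      rw [hderiv s hs.1]
      exact abs_corr_le hbound φ _)
  simpa using this

end Corr

/-! ### The averaging box and the main estimate. -/

/-- The lower corner of the box `[0, r]^m × [-r, r]^{d-m}`. -/
def lowerCorner (d m : ℕ) (r : ℝ) : Fin d → ℝ := fun i => if (i : ℕ) < m then 0 else -r

/-- The box `[0, r]^m × [-r, r]^{d-m}`. -/
def coneBox (d m : ℕ) (r : ℝ) : Set (Fin d → ℝ) := Set.Icc (lowerCorner d m r) fun _ => r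

theorem mem_coneBox {d m : ℕ} (hd : 1 ≤ d) {r : ℝ} {x : Fin d → ℝ} :
    x ∈ coneBox d m r ↔ (∀ i : Fin d, (i : ℕ) < m → 0 ≤ x i) ∧ ‖x‖ ≤ r := by
  have : Nonempty (Fin d) := ⟨⟨0, hd⟩⟩
  rw [pi_norm_le_iff_of_nonempty, coneBox, Set.mem_Icc, Pi.le_def, Pi.le_def]
  simp only [lowerCorner, Real.norm_eq_abs, abs_le]
  constructor
  · rintro ⟨h1, h2⟩
    refine ⟨fun i hi => by simpa [hi] using h1 i, fun i => ⟨?_, h2 i⟩⟩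
    have h3 := h1 i
    have h4 := h2 i
    split_ifs at h3 <;> linarith
  · rintro ⟨h1, h2⟩
    refine ⟨fun i => ?_, fun i => (h2 i).2⟩
    split_ifs with hi
    · exact h1 i hi
    · exact (h2 i).1

theorem volume_real_coneBox {d m : ℕ} (hm : m ≤ d) {r : ℝ} (hr : 0 ≤ r) :
    volume.real (coneBox d m r) = 2 ^ (d - m) * r ^ d := by
  rw [coneBox, measureReal_def, Real.volume_Icc_pi_toReal]
  · have h1 : ∀ i : Fin d, r - lowerCorner d m r i = r * if (i : ℕ) < m then 1 else 2 := by
      intro i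
      rw [lowerCorner]
      split_ifs <;> ring
    simp only [h1, Finset.prod_mul_distrib, Finset.prod_const, Finset.card_univ, Fintype.card_fin]
    rw [Fin.prod_univ_eq_prod_range (fun i => if i < m then (1 : ℝ) else 2) d,
      ← Finset.prod_range_mul_prod_Ico _ hm, Finset.prod_congr rfl (g := fun _ => (1 : ℝ)),
      Finset.prod_congr (s₁ := Finset.Ico m d) rfl (g := fun _ => (2 : ℝ))]
    · simp [mul_comm]
    · intro i hi
      rw [if_neg (by simp at hi; omega)]
    · intro i hi
      rw [if_pos (by simpa using hi)]
  · intro i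
    rw [lowerCorner]
    split_ifs <;> linarith

/-- Layer-cake formula: inside the box of size h, the set where h - ‖y‖ ≥ t is the box of size h -
t, so the integral is that of 2^(d-m) (h - t)^d over 0 < t ≤ h. -/
theorem integral_coneBox_sub_norm {d m : ℕ} (hd : 1 ≤ d) (hm : m ≤ d) {h : ℝ} (hh : 0 ≤ h) :
    ∫ y in coneBox d m h, (h - ‖y‖) = 2 ^ (d - m) * h ^ (d + 1) / (d + 1) := by
  have hint : IntegrableOn (fun y : Fin d → ℝ => h - ‖y‖) (coneBox d m h) :=
    (continuous_const.sub continuous_norm).continuousOn.integrableOn_compact isCompact_Icc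
  have hmeas : MeasurableSet (coneBox d m h) := measurableSet_Icc
  rw [Integrable.integral_eq_integral_meas_le hint]
  · have h1 : ∀ t ∈ Set.Ioi (0 : ℝ),
        (volume.restrict (coneBox d m h)).real {y : Fin d → ℝ | t ≤ h - ‖y‖} =
          (Set.Ioc 0 h).indicator (fun t => 2 ^ (d - m) * (h - t) ^ d) t := by
      intro t ht
      rw [measureReal_restrict_apply' hmeas]
      by_cases hth : t ≤ h
      · rw [Set.indicator_of_mem (show t ∈ Set.Ioc 0 h from ⟨ht, hth⟩), ← volume_real_coneBox hm (sub_nonneg.2 hth)]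
        congr 1
        ext y
        rw [Set.mem_inter_iff, mem_coneBox hd, mem_coneBox hd, Set.mem_ofPred_eq]
        have ht' : 0 < t := ht
        constructor
        · rintro ⟨h1, h2, h3⟩
          exact ⟨h2, by linarith⟩
        · rintro ⟨h1, h2⟩
          exact ⟨by linarith, h1, by linarith⟩
      · rw [Set.indicator_of_notMem (fun h' => hth h'.2)]
        have : {y : Fin d → ℝ | t ≤ h - ‖y‖} ∩ coneBox d m h = ∅ := by
          ext y
          simp only [Set.mem_inter_iff, Set.mem_ofPred_eq, Set.mem_empty_iff_false, iff_false]
          rintro ⟨h2, -⟩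
          have := norm_nonneg y
          linarith
        simp [this]
    rw [setIntegral_congr_fun measurableSet_Ioi h1,
      setIntegral_indicator measurableSet_Ioc]
    have : Set.Ioi (0 : ℝ) ∩ Set.Ioc 0 h = Set.Ioc 0 h :=
      Set.inter_eq_right.2 fun t ht => ht.1
    rw [this, ← intervalIntegral.integral_of_le hh, intervalIntegral.integral_const_mul,
      intervalIntegral.integral_comp_sub_left (fun t => t ^ d), integral_pow]
    simp
    ring
  · filter_upwards [ae_restrict_mem hmeas] with y hy
    have := ((mem_coneBox hd).1 hy).2
    simpa using this

/-- The additive inequality in dual form: vol(Q) U(0) is the integral over Q of U plus that of U(0)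
- U, estimated by `hmean` and `hdev`. -/
theorem abs_corr_zero_le {d m : ℕ} (hd : 1 ≤ d) (hm : m ≤ d) {f g : (Fin d → ℝ) → ℝ}
    {G : Fin d → (Fin d → ℝ) → ℝ} {F Γ : ℝ}
    (hf : LocallyIntegrable ((cone d m : Set (Fin d → ℝ)).indicator f))
    (hg : LocallyIntegrable ((cone d m : Set (Fin d → ℝ)).indicator g))
    (hG : ∀ i, LocallyIntegrable ((cone d m : Set (Fin d → ℝ)).indicator (G i)))
    (hfg : HasWeakMixed (cone d m) f g) (h : ∀ i, HasWeakPartial (cone d m) i g (G i))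
    (hF0 : 0 ≤ F) (hF : ∀ᵐ x ∂(leb (cone d m)), |f x| ≤ F)
    (hΓ0 : 0 ≤ Γ) (hΓ : ∀ᵐ x ∂(leb (cone d m)), ∑ i, |G i x| ≤ Γ) (φ : 𝓓(cone d m, ℝ))
    {r : ℝ} (hr : 0 < r) :
    |corr ((cone d m : Set (Fin d → ℝ)).indicator g) φ 0| ≤
      (r * ((d : ℝ) / (d + 1)) * Γ + 2 ^ m / r ^ d * F) * ∫ x, |φ x| := by
  set Q := coneBox d m r with hQ
  set U := corr ((cone d m : Set (Fin d → ℝ)).indicator g) φ with hU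
  set N := ∫ x, |φ x| with hN
  have hQm : MeasurableSet Q := measurableSet_Icc
  have hQv : volume Q ≠ ⊤ := isCompact_Icc.measure_lt_top.ne
  have hUc : Continuous U := continuous_corr hg φ
  have hUi : IntegrableOn U Q := hUc.continuousOn.integrableOn_compact isCompact_Icc
  have hci : ∀ c : ℝ, IntegrableOn (fun _ : Fin d → ℝ => c) Q := fun c =>
    integrableOn_const hQv
  have hni : IntegrableOn (fun y : Fin d → ℝ => ‖y‖) Q :=
    continuous_norm.continuousOn.integrableOn_compact isCompact_Icc
  have hF' : ∀ᵐ x, |(cone d m : Set (Fin d → ℝ)).indicator f x| ≤ F := by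
    rw [leb, ae_restrict_iff' (cone d m).isOpen.measurableSet] at hF
    filter_upwards [hF] with x hx
    by_cases hxΩ : x ∈ (cone d m : Set (Fin d → ℝ))
    · simpa [Set.indicator_of_mem hxΩ] using hx hxΩ
    · simpa [Set.indicator_of_notMem hxΩ] using hF0
  have hmean : |∫ y in Q, U y| ≤ 2 ^ d * (F * N) := by
    have hle : lowerCorner d m r ≤ fun _ => r := by
      intro i
      simp only [lowerCorner]
      split_ifs <;> linarith
    have h1 := abs_setIntegral_corr_iteratedLineDerivOp_le hf hF'
      (fun i : Fin d => basisVec i) φ 0 hle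
    have h2 : ∫ y in Q, U y = (-1) ^ d * ∫ t in Set.Icc (lowerCorner d m r) fun _ => r,
        corr ((cone d m : Set (Fin d → ℝ)).indicator f)
          ⇑(∂^{fun i : Fin d => basisVec i} φ : 𝓓(cone d m, ℝ)) (0 + ∑ i, t i • basisVec i) := by
      rw [← integral_const_mul]
      refine setIntegral_congr_fun hQm fun y hy => ?_
      have hy' : (0 : Fin d → ℝ) + ∑ i, y i • basisVec i = y := by
        simpa [basisVec] using (pi_eq_sum_univ' y).symm
      rw [hy', hfg.corr_eq φ (add_mem_cone ((mem_coneBox hd).1 hy).1), ← mul_assoc, ← mul_pow]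
      simp [hU]
    rw [h2, abs_mul, abs_pow]
    simpa using h1
  have hdev : |∫ y in Q, (U 0 - U y)| ≤ ∫ y in Q, Γ * N * ‖y‖ := by
    rw [← Real.norm_eq_abs]
    refine norm_integral_le_of_norm_le (hni.const_mul _) ?_
    filter_upwards [ae_restrict_mem hQm] with y hy
    rw [← neg_sub, norm_neg, Real.norm_eq_abs]
    refine (abs_corr_sub_corr_zero_le hg hG h hΓ0 hΓ φ ?_).trans_eq (by rw [hN]; ring)
    intro s hs
    refine add_mem_cone fun i hi => ?_
    simpa using mul_nonneg hs (((mem_coneBox hd).1 hy).1 i hi)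
  have hvol := volume_real_coneBox hm hr.le
  have hnorm := integral_coneBox_sub_norm hd hm hr.le
  rw [integral_sub (hci r) hni, setIntegral_const, hvol, smul_eq_mul] at hnorm
  rw [integral_const_mul] at hdev
  rw [integral_sub (hci _) hUi, setIntegral_const, hvol, smul_eq_mul] at hdev
  have hV : (0 : ℝ) < 2 ^ (d - m) * r ^ d := by positivity
  have hmain : 2 ^ (d - m) * r ^ d * |U 0| ≤
      2 ^ d * (F * N) + Γ * N * ∫ y in Q, ‖y‖ := by
    have h0 : 2 ^ (d - m) * r ^ d * |U 0| = |2 ^ (d - m) * r ^ d * U 0| := by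
      rw [abs_mul, abs_of_pos hV]
    rw [h0]
    refine le_trans ?_ (add_le_add hmean hdev)
    refine le_trans (le_of_eq ?_) (abs_add_le _ _)
    congr 1
    ring
  -- The constant 2^m is the number 2^d of corners divided by the factor 2^(d-m) of the volume.
  have hpow : (2 : ℝ) ^ d = 2 ^ (d - m) * 2 ^ m := by rw [← pow_add, Nat.sub_add_cancel hm]
  have hd1 : (0 : ℝ) < d + 1 := by positivity
  rw [← mul_le_mul_iff_right₀ hV]
  refine hmain.trans_eq ?_
  have : ∫ y in Q, ‖y‖ = 2 ^ (d - m) * r ^ d * r - 2 ^ (d - m) * r ^ (d + 1) / (d + 1) := by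
    rw [← hnorm]; ring
  rw [this, hpow]
  field_simp
  ring

/-! ### From the dual estimate to sup norms, and the choice of scale. -/

theorem ae_abs_le_of_forall_abs_corr_le {d : ℕ} {Ω : Opens (Fin d → ℝ)} {g : (Fin d → ℝ) → ℝ}
    (hg : LocallyIntegrable ((Ω : Set (Fin d → ℝ)).indicator g)) {B : ℝ}
    (hB : ∀ φ : 𝓓(Ω, ℝ), |corr ((Ω : Set (Fin d → ℝ)).indicator g) φ 0| ≤ B * ∫ x, |φ x|) :
    ∀ᵐ x ∂(leb Ω), |g x| ≤ B := by
  -- Normalized bumps with shrinking radii in the fixed ratio 2, as Lebesgue differentiation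
  -- requires; they have L¹ norm 1, so the bound B passes to the limit.
  let b : ℕ → ContDiffBump (0 : Fin d → ℝ) := fun n =>
    ⟨1 / ((n : ℝ) + 1), 2 * (1 / ((n : ℝ) + 1)), by positivity, by
      have : (0 : ℝ) < 1 / ((n : ℝ) + 1) := by positivity
      linarith⟩
  have hlim : Filter.Tendsto (fun n => (b n).rOut) Filter.atTop (nhds 0) := by
    have h0 := (tendsto_one_div_add_atTop_nhds_zero_nat (𝕜 := ℝ)).const_mul 2
    rwa [mul_zero] at h0
  have hae := ContDiffBump.ae_convolution_tendsto_right_of_locallyIntegrable (μ := volume)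
    (K := 2) hlim (Filter.Eventually.of_forall fun n => le_rfl) hg
  rw [leb, ae_restrict_iff' Ω.isOpen.measurableSet]
  filter_upwards [hae] with x hx hxΩ
  rw [Set.indicator_of_mem hxΩ] at hx
  refine le_of_tendsto hx.abs ?_
  obtain ⟨ε, hε, hball⟩ := Metric.isOpen_iff.1 Ω.isOpen x hxΩ
  filter_upwards [hlim.eventually (gt_mem_nhds hε)] with n hn
  let ψ : 𝓓(Ω, ℝ) :=
    { toFun := fun y => (b n).normed volume (x - y)
      contDiff' := (b n).contDiff_normed.comp (contDiff_const.sub contDiff_id)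
      hasCompactSupport' :=
        ((b n).hasCompactSupport_normed).comp_homeomorph (Homeomorph.subLeft x)
      tsupport_subset' := by
        have h1 := tsupport_comp_eq_preimage ((b n).normed volume) (Homeomorph.subLeft x)
        intro y hy
        have hy' : y ∈ tsupport ((b n).normed volume ∘ Homeomorph.subLeft x) := hy
        rw [h1, Set.mem_preimage, ContDiffBump.tsupport_normed_eq] at hy'
        refine hball ?_
        rw [Metric.mem_ball, dist_comm, dist_eq_norm]
        have : ‖x - y‖ ≤ (b n).rOut := by simpa using hy'
        linarith }
  have hψ : ∀ y, ψ y = (b n).normed volume (x - y) := fun _ => rfl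
  have h1 : ∫ y, |ψ y| = 1 := by
    simp only [hψ]
    rw [integral_sub_left_eq_self (fun y => |(b n).normed volume y|) volume x]
    simp only [abs_of_nonneg ((b n).nonneg_normed _)]
    exact (b n).integral_normed
  have h2 := hB ψ
  rw [h1, mul_one] at h2
  have h3 : convolution ((b n).normed volume) ((Ω : Set (Fin d → ℝ)).indicator g)
      (ContinuousLinearMap.lsmul ℝ ℝ) volume x =
        corr ((Ω : Set (Fin d → ℝ)).indicator g) ψ 0 := by
    rw [convolution_eq_swap, corr]
    refine integral_congr_ae (Filter.Eventually.of_forall fun y => ?_)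
    simp [hψ, mul_comm]
  rw [h3]
  exact h2

/-- Optimizing the scale in the additive inequality yields the multiplicative one. -/
theorem le_rpow_mul_rpow_of_forall_le {d : ℕ} (hd : 1 ≤ d) {A B Γ : ℝ} (hB : 0 ≤ B)
    (hΓ : 0 ≤ Γ)
    (h : ∀ r : ℝ, 0 < r → A ≤ r * ((d : ℝ) / (d + 1)) * Γ + B / r ^ d) :
    A ≤ ((d + 1) * B) ^ ((1 : ℝ) / (d + 1)) * Γ ^ ((d : ℝ) / (d + 1)) := by
  have hd0 : (0 : ℝ) < d := by exact_mod_cast hd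
  have hd1 : (0 : ℝ) < (d : ℝ) + 1 := by positivity
  have hdne : d ≠ 0 := by omega
  -- In the degenerate cases there is no optimal scale: let r tend to 0 if B = 0, and to infinity if
  -- Γ = 0.
  rcases hB.eq_or_lt with rfl | hB
  · have hlim : Filter.Tendsto (fun r : ℝ => r * ((d : ℝ) / (d + 1)) * Γ + 0 / r ^ d)
        (nhdsWithin 0 (Set.Ioi 0)) (nhds 0) := by
      have : Continuous fun r : ℝ => r * ((d : ℝ) / (d + 1)) * Γ := by fun_prop
      simpa using (this.tendsto 0).mono_left nhdsWithin_le_nhds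
    have hA0 : A ≤ 0 := ge_of_tendsto hlim
      (Filter.eventually_of_mem self_mem_nhdsWithin fun r hr => h r hr)
    exact hA0.trans (by positivity)
  rcases hΓ.eq_or_lt with rfl | hΓ
  · have hlim : Filter.Tendsto (fun r : ℝ => r * ((d : ℝ) / (d + 1)) * 0 + B / r ^ d)
        Filter.atTop (nhds 0) := by
      simpa using (Filter.tendsto_pow_atTop (α := ℝ) hdne).const_div_atTop B
    have hA0 : A ≤ 0 := ge_of_tendsto hlim
      ((Filter.eventually_gt_atTop 0).mono fun r hr => h r hr)
    exact hA0.trans (by positivity)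
  -- The minimizing scale satisfies r^(d+1) = q; there the two terms add up to r Γ.
  set q : ℝ := (d + 1) * B / Γ with hq
  have hq0 : 0 < q := by positivity
  set r : ℝ := q ^ ((1 : ℝ) / (d + 1)) with hr
  have hr0 : 0 < r := Real.rpow_pos_of_pos hq0 _
  have hrd : r ^ (d + 1) = q := by
    rw [hr, ← Real.rpow_natCast, ← Real.rpow_mul hq0.le]
    push_cast
    rw [one_div_mul_cancel hd1.ne', Real.rpow_one]
  have hBr : B / r ^ d = r * Γ / (d + 1) := by
    have : B = r ^ (d + 1) * Γ / (d + 1) := by rw [hrd, hq]; field_simp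
    rw [this, pow_succ]
    field_simp
  have h1 := h r hr0
  rw [hBr] at h1
  have h2 : r * ((d : ℝ) / (d + 1)) * Γ + r * Γ / (d + 1) = r * Γ := by field_simp
  rw [h2] at h1
  refine h1.trans_eq ?_
  have h3 : Γ = Γ ^ ((1 : ℝ) / (d + 1)) * Γ ^ ((d : ℝ) / (d + 1)) := by
    rw [← Real.rpow_add hΓ, ← add_div, add_comm (1 : ℝ), div_self hd1.ne', Real.rpow_one]
  conv_lhs => rw [h3]
  rw [← mul_assoc, hr, ← Real.mul_rpow hq0.le hΓ.le, hq, div_mul_cancel₀ _ hΓ.ne']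

/-! ### Sup norms and independence of the chosen weak derivatives. -/

section Linf

variable {d : ℕ} {Ω : Opens (Fin d → ℝ)}

theorem MemLinf.locallyIntegrable_indicator {f : (Fin d → ℝ) → ℝ} (hf : MemLinf Ω f) :
    LocallyIntegrable ((Ω : Set (Fin d → ℝ)).indicator f) :=
  ((memLp_indicator_iff_restrict Ω.isOpen.measurableSet).2 hf).locallyIntegrable le_top

theorem MemLinf.locallyIntegrableOn {f : (Fin d → ℝ) → ℝ} (hf : MemLinf Ω f) :
    LocallyIntegrableOn f (Ω : Set (Fin d → ℝ)) := by
  have : IsLocallyFiniteMeasure (leb Ω) := by unfold leb; infer_instance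
  exact locallyIntegrableOn_of_locallyIntegrable_restrict (hf.locallyIntegrable le_top)

theorem MemLinf.ae_abs_le {f : (Fin d → ℝ) → ℝ} (hf : MemLinf Ω f) :
    ∀ᵐ x ∂(leb Ω), |f x| ≤ normLinf Ω f := by
  have h1 := ae_le_eLpNormEssSup (f := f) (μ := leb Ω)
  have h2 : eLpNormEssSup f (leb Ω) ≠ ⊤ := by
    rw [← eLpNorm_exponent_top]; exact hf.2.ne
  filter_upwards [h1] with x hx
  rw [normLinf, ← toReal_eLpNorm hf.1, eLpNorm_exponent_top, ← Real.norm_eq_abs, ← toReal_enorm]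
  exact ENNReal.toReal_mono h2 hx

theorem normLinf_nonneg (f : (Fin d → ℝ) → ℝ) : 0 ≤ normLinf Ω f := lpNorm_nonneg

theorem normLinf_le {f : (Fin d → ℝ) → ℝ} {B : ℝ} (hB : 0 ≤ B)
    (h : ∀ᵐ x ∂(leb Ω), |f x| ≤ B) : normLinf Ω f ≤ B := by
  -- `lpNorm` takes the default value 0 on functions that are not a.e. strongly measurable.
  by_cases hf : AEStronglyMeasurable f (leb Ω)
  · rw [normLinf, ← toReal_eLpNorm hf, eLpNorm_exponent_top]
    exact ENNReal.toReal_le_of_le_ofReal hB (eLpNormEssSup_le_of_ae_bound h)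
  · rw [normLinf, lpNorm_of_not_aestronglyMeasurable hf]
    exact hB

/-- Fundamental lemma of the calculus of variations. It makes weak derivatives unique up to null
sets, so that facts about any representative pass to `weakMixed` and `weakPartial`. -/
theorem ae_eq_of_forall_integral_testFunction_eq {g g' : (Fin d → ℝ) → ℝ}
    (hg : LocallyIntegrableOn g (Ω : Set (Fin d → ℝ)))
    (hg' : LocallyIntegrableOn g' (Ω : Set (Fin d → ℝ)))
    (h : ∀ φ : 𝓓(Ω, ℝ), ∫ x, g x * φ x ∂(leb Ω) = ∫ x, g' x * φ x ∂(leb Ω)) :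
    g =ᵐ[leb Ω] g' := by
  have hae := Ω.isOpen.ae_eq_zero_of_integral_contDiff_smul_eq_zero (hg.sub hg') (μ := volume)
    (fun φ hφ hφc hφΩ => by
      let ψ : 𝓓(Ω, ℝ) := ⟨φ, hφ, hφc, hφΩ⟩
      have h1 := h ψ
      have hi : ∀ u : (Fin d → ℝ) → ℝ, LocallyIntegrableOn u (Ω : Set (Fin d → ℝ)) →
          Integrable fun x => u x * ψ x := fun u hu => by
        have := ψ.integrable_bilin (ContinuousLinearMap.mul ℝ ℝ) (φ := u) (μ := volume) hu
        simpa [mul_comm] using this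
      have hr : ∀ u : (Fin d → ℝ) → ℝ, ∫ x, u x * ψ x ∂(leb Ω) = ∫ x, u x * ψ x := fun u =>
        setIntegral_eq_integral_of_forall_compl_eq_zero fun x hx => by
          rw [image_eq_zero_of_notMem_tsupport fun hx' => hx (ψ.tsupport_subset hx'), mul_zero]
      rw [hr, hr, ← sub_eq_zero, ← integral_sub (hi g hg) (hi g' hg')] at h1
      rw [← h1]
      refine integral_congr_ae (Filter.Eventually.of_forall fun x => ?_)
      change φ x * (g x - g' x) = g x * φ x - g' x * φ x
      ring)
  rw [leb, Filter.EventuallyEq, ae_restrict_iff' Ω.isOpen.measurableSet]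
  filter_upwards [hae] with x hx hxΩ
  exact sub_eq_zero.1 (hx hxΩ)

theorem HasWeakMixed.ae_eq {f g g' : (Fin d → ℝ) → ℝ} (h : HasWeakMixed Ω f g)
    (h' : HasWeakMixed Ω f g') : g =ᵐ[leb Ω] g' :=
  ae_eq_of_forall_integral_testFunction_eq h.2.1 h'.2.1 fun φ => by
    have := (h.2.2 φ).symm.trans (h'.2.2 φ)
    exact mul_left_cancel₀ (pow_ne_zero _ (by norm_num)) this

theorem HasWeakPartial.ae_eq {i : Fin d} {g G G' : (Fin d → ℝ) → ℝ} (h : HasWeakPartial Ω i g G)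
    (h' : HasWeakPartial Ω i g G') : G =ᵐ[leb Ω] G' :=
  ae_eq_of_forall_integral_testFunction_eq h.2.1 h'.2.1 fun φ =>
    neg_injective ((h.2.2 φ).symm.trans (h'.2.2 φ))

theorem HasWeakPartial.congr_left {i : Fin d} {g g' G : (Fin d → ℝ) → ℝ}
    (h : HasWeakPartial Ω i g G) (hg' : LocallyIntegrableOn g' (Ω : Set (Fin d → ℝ)))
    (hgg' : g =ᵐ[leb Ω] g') : HasWeakPartial Ω i g' G :=
  ⟨hg', h.2.1, fun φ => by
    rw [← h.2.2 φ]
    refine integral_congr_ae ?_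
    filter_upwards [hgg'] with x hx
    rw [hx]⟩

theorem HasWeakMixed.weakMixed {f g : (Fin d → ℝ) → ℝ} (h : HasWeakMixed Ω f g) :
    HasWeakMixed Ω f (weakMixed Ω f) := by
  have hex : ∃ g, HasWeakMixed Ω f g := ⟨g, h⟩
  rw [MixedDeriv.weakMixed, dif_pos hex]
  exact hex.choose_spec

theorem HasWeakPartial.weakPartial {i : Fin d} {g G : (Fin d → ℝ) → ℝ}
    (h : HasWeakPartial Ω i g G) : HasWeakPartial Ω i g (weakPartial Ω i g) := by
  have hex : ∃ G, HasWeakPartial Ω i g G := ⟨G, h⟩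
  rw [MixedDeriv.weakPartial, dif_pos hex]
  exact hex.choose_spec

theorem memLinf_weakMixed {f : (Fin d → ℝ) → ℝ} (hf : MemMixed Ω f) :
    MemLinf Ω (weakMixed Ω f) := by
  obtain ⟨-, g, hfg, hg, -⟩ := hf
  exact hg.ae_eq (hfg.ae_eq hfg.weakMixed)

theorem hasWeakPartial_weakMixed {f : (Fin d → ℝ) → ℝ} (hf : MemMixed Ω f) (i : Fin d) :
    HasWeakPartial Ω i (weakMixed Ω f) (weakPartial Ω i (weakMixed Ω f)) ∧
      MemLinf Ω (weakPartial Ω i (weakMixed Ω f)) := by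
  obtain ⟨-, g, hfg, -, hG⟩ := hf
  obtain ⟨G, hgG, hGm⟩ := hG i
  have h := hgG.congr_left hfg.weakMixed.2.1 (hfg.ae_eq hfg.weakMixed)
  exact ⟨h.weakPartial, hGm.ae_eq (h.ae_eq h.weakPartial)⟩

theorem memLinf_gradNormOne_weakMixed {f : (Fin d → ℝ) → ℝ} (hf : MemMixed Ω f) :
    MemLinf Ω (gradNormOne Ω (weakMixed Ω f)) :=
  memLp_finsetSum (f := fun i x => |weakPartial Ω i (weakMixed Ω f) x|) _
    fun i _ => (hasWeakPartial_weakMixed hf i).2.abs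

theorem gradNormOne_weakMixed_ae_eq {f g : (Fin d → ℝ) → ℝ} {G : Fin d → (Fin d → ℝ) → ℝ}
    (hfg : HasWeakMixed Ω f g) (hG : ∀ i, HasWeakPartial Ω i g (G i)) :
    gradNormOne Ω (weakMixed Ω f) =ᵐ[leb Ω] fun x => ∑ i, |G i x| := by
  have h : ∀ᵐ x ∂(leb Ω), ∀ i, weakPartial Ω i (weakMixed Ω f) x = G i x :=
    ae_all_iff.2 fun i => by
      have h := (hG i).congr_left hfg.weakMixed.2.1 (hfg.ae_eq hfg.weakMixed)
      exact h.weakPartial.ae_eq h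
  filter_upwards [h] with x hx
  simp only [gradNormOne, hx]

end Linf

/-! ### The two inequalities. -/

theorem normLinf_weakMixed_le_add {d m : ℕ} (hd : 1 ≤ d) (hm : m ≤ d) {f : (Fin d → ℝ) → ℝ}
    (hf : MemMixed (cone d m) f) {r : ℝ} (hr : 0 < r) :
    normLinf (cone d m) (weakMixed (cone d m) f) ≤
      r * ((d : ℝ) / (d + 1)) * normLinf (cone d m) (gradNormOne (cone d m)
        (weakMixed (cone d m) f)) + 2 ^ m / r ^ d * normLinf (cone d m) f := by
  have hfm := hf.1
  have hgm := memLinf_weakMixed hf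
  have hGm := hasWeakPartial_weakMixed hf
  have hgrad := memLinf_gradNormOne_weakMixed hf
  have hF0 := normLinf_nonneg (Ω := cone d m) f
  have hΓ0 := normLinf_nonneg (Ω := cone d m) (gradNormOne (cone d m) (weakMixed (cone d m) f))
  refine normLinf_le (by positivity) ?_
  refine ae_abs_le_of_forall_abs_corr_le hgm.locallyIntegrable_indicator fun φ => ?_
  refine abs_corr_zero_le hd hm hfm.locallyIntegrable_indicator hgm.locallyIntegrable_indicator
    (fun i => (hGm i).2.locallyIntegrable_indicator) ?_ (fun i => (hGm i).1) hF0 hfm.ae_abs_le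
    hΓ0 ?_ φ hr
  · obtain ⟨-, g, hfg, -⟩ := hf
    exact hfg.weakMixed
  · filter_upwards [hgrad.ae_abs_le] with x hx
    exact (le_abs_self _).trans hx

theorem normLinf_weakMixed_le_mul {d m : ℕ} (hd : 1 ≤ d) (hm : m ≤ d) {f : (Fin d → ℝ) → ℝ}
    (hf : MemMixed (cone d m) f) :
    normLinf (cone d m) (weakMixed (cone d m) f) ≤
      (2 ^ m * ((d : ℝ) + 1) * normLinf (cone d m) f) ^ ((1 : ℝ) / (d + 1)) *
        normLinf (cone d m) (gradNormOne (cone d m) (weakMixed (cone d m) f))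
          ^ ((d : ℝ) / (d + 1)) := by
  have h := le_rpow_mul_rpow_of_forall_le hd
    (mul_nonneg (by positivity : (0 : ℝ) ≤ 2 ^ m) (normLinf_nonneg (Ω := cone d m) f))
    (normLinf_nonneg (Ω := cone d m) (gradNormOne (cone d m) (weakMixed (cone d m) f)))
    fun r hr => (normLinf_weakMixed_le_add hd hm hf hr).trans_eq (by ring)
  refine h.trans_eq ?_
  congr 2
  ring

/-! ### A fundamental solution of the mixed derivative. -/

/-- Half the sign of `t - s`, a fundamental solution of `d/dt` with pole `s`. -/
def halfSign (s t : ℝ) : ℝ := if s < t then 1 / 2 else -(1 / 2)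

theorem abs_halfSign (s t : ℝ) : |halfSign s t| = 1 / 2 := by
  unfold halfSign
  split_ifs <;> norm_num [abs_of_pos]

theorem measurable_halfSign : Measurable fun p : ℝ × ℝ => halfSign p.1 p.2 :=
  Measurable.ite (measurableSet_lt measurable_fst measurable_snd) measurable_const
    measurable_const

theorem integral_halfSign_mul_deriv {ψ : ℝ → ℝ} (hψ : ContDiff ℝ 1 ψ)
    (hc : HasCompactSupport ψ) (s : ℝ) : ∫ t, halfSign s t * deriv ψ t = -ψ s := by
  have hi : Integrable (deriv ψ) :=
    (hψ.continuous_deriv le_rfl).integrable_of_hasCompactSupport hc.deriv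
  have hm : Measurable (halfSign s) := measurable_halfSign.comp measurable_prodMk_left
  have hi' : Integrable fun t => halfSign s t * deriv ψ t :=
    hi.bdd_mul hm.aestronglyMeasurable
      (Filter.Eventually.of_forall fun t => (abs_halfSign s t).le)
  rw [← intervalIntegral.integral_Iic_add_Ioi hi'.integrableOn hi'.integrableOn (b := s),
    setIntegral_congr_fun (g := fun t => -(1 / 2) * deriv ψ t) measurableSet_Iic,
    setIntegral_congr_fun (s := Set.Ioi s) (g := fun t => 1 / 2 * deriv ψ t) measurableSet_Ioi,
    integral_const_mul, integral_const_mul, hc.integral_Iic_deriv_eq hψ,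
    hc.integral_Ioi_deriv_eq hψ]
  · ring
  · intro t ht
    simp only [halfSign, if_pos (Set.mem_Ioi.1 ht)]
  · intro t ht
    simp only [halfSign, if_neg (not_lt.2 (Set.mem_Iic.1 ht))]

/-- Ensures that a test function restricted to an affine subspace is compactly supported in the
parameters. -/
theorem isClosedEmbedding_add_sum_smul {d n : ℕ} {v : Fin n → Fin d → ℝ}
    (hv : LinearIndependent ℝ v) (p : Fin d → ℝ) :
    Topology.IsClosedEmbedding fun t : Fin n → ℝ => p + ∑ i, t i • v i := by
  have h1 := LinearMap.isClosedEmbedding_of_injective (f := Fintype.linearCombination ℝ v)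
    (LinearMap.ker_eq_bot.2 (linearIndependent_iff_injective_fintypeLinearCombination.1 hv))
  exact (Homeomorph.addLeft p).isClosedEmbedding.comp h1

theorem measurable_prod_halfSign (n : ℕ) :
    Measurable fun p : (Fin n → ℝ) × (Fin n → ℝ) => ∏ i, halfSign (p.1 i) (p.2 i) :=
  Finset.measurable_prod _ fun i _ =>
    (measurable_halfSign.comp
      (((measurable_pi_apply i).comp measurable_fst).prodMk
        ((measurable_pi_apply i).comp measurable_snd)) :
      Measurable ((fun q : ℝ × ℝ => halfSign q.1 q.2) ∘
        fun p : (Fin n → ℝ) × (Fin n → ℝ) => (p.1 i, p.2 i)))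

theorem abs_prod_halfSign {n : ℕ} (s t : Fin n → ℝ) :
    |∏ i, halfSign (s i) (t i)| = (1 / 2) ^ n := by
  rw [Finset.abs_prod]
  simp [abs_halfSign]

/-- By Fubini, one variable at a time: each half sign undoes one derivative, evaluates at sᵢ and
contributes a factor -1. -/
theorem integral_prod_halfSign_mul_iteratedLineDerivOp {d : ℕ} {Ω : Opens (Fin d → ℝ)} {n : ℕ}
    {v : Fin n → Fin d → ℝ} (hv : LinearIndependent ℝ v) (φ : 𝓓(Ω, ℝ)) (p : Fin d → ℝ)
    (s : Fin n → ℝ) :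
    ∫ t : Fin n → ℝ, (∏ i, halfSign (s i) (t i)) * (∂^{v} φ) (p + ∑ i, t i • v i) =
      (-1) ^ n * φ (p + ∑ i, s i • v i) := by
  induction n generalizing p with
  | zero => simp [integral_unique, measureReal_def, volume_pi]
  | succ n ih =>
    have hi : Integrable fun t : Fin (n + 1) → ℝ =>
        (∏ i, halfSign (s i) (t i)) * (∂^{v} φ) (p + ∑ i, t i • v i) := by
      have h1 := isClosedEmbedding_add_sum_smul hv p
      have h2 : Integrable fun t : Fin (n + 1) → ℝ => (∂^{v} φ) (p + ∑ i, t i • v i) :=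
        ((∂^{v} φ).continuous.comp h1.continuous).integrable_of_hasCompactSupport
          ((∂^{v} φ).hasCompactSupport.comp_isClosedEmbedding h1)
      exact h2.bdd_mul
        ((measurable_prod_halfSign (n + 1)).comp measurable_prodMk_left).aestronglyMeasurable
        (Filter.Eventually.of_forall fun t => (abs_prod_halfSign s t).le)
    rw [integral_fin_succ hi]
    have hvt : LinearIndependent ℝ (Fin.tail v) :=
      hv.comp Fin.succ (Fin.succ_injective n)
    have hin : ∀ t' : Fin n → ℝ, ∫ t0 : ℝ,
        (∏ i, halfSign (s i) ((Fin.cons t0 t' : Fin (n + 1) → ℝ) i)) *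
          (∂^{v} φ) (p + ∑ i, (Fin.cons t0 t' : Fin (n + 1) → ℝ) i • v i) =
        -((∏ i, halfSign (Fin.tail s i) (t' i)) *
          (∂^{Fin.tail v} φ) ((p + s 0 • v 0) + ∑ i, t' i • Fin.tail v i)) := by
      intro t'
      set q := p + ∑ i, t' i • Fin.tail v i with hq
      set ψ := (∂^{Fin.tail v} φ) with hψ
      have hemb : Topology.IsClosedEmbedding fun t0 : ℝ => q + t0 • v 0 :=
        (Homeomorph.addLeft q).isClosedEmbedding.comp
          (isClosedEmbedding_smul_left (hv.ne_zero 0))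
      have hcd : ContDiff ℝ 1 fun t0 : ℝ => ψ (q + t0 • v 0) :=
        (ψ.contDiff.of_le (by simp)).comp (by fun_prop)
      have h1 := integral_halfSign_mul_deriv hcd
        (ψ.hasCompactSupport.comp_isClosedEmbedding hemb) (s 0)
      have h2 : ∀ t0 : ℝ, deriv (fun t0 : ℝ => ψ (q + t0 • v 0)) t0 =
          (∂_{v 0} ψ) (q + t0 • v 0) := fun t0 => by
        rw [lineDerivOp_testFunction_apply]
        have h3 : HasDerivAt (fun t : ℝ => q + t • v 0) (v 0) t0 := by
          simpa using ((hasDerivAt_id t0).smul_const (v 0)).const_add q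
        exact ((ψ.contDiff.differentiable (by simp) _).hasFDerivAt.comp_hasDerivAt t0 h3).deriv
      simp only [h2] at h1
      have h4 : (p + s 0 • v 0) + ∑ i, t' i • Fin.tail v i = q + s 0 • v 0 := by
        rw [hq]; abel
      rw [h4, ← mul_neg, ← h1, ← integral_const_mul]
      refine integral_congr_ae (Filter.Eventually.of_forall fun t0 => ?_)
      have h5 : p + ∑ i, (Fin.cons t0 t' : Fin (n + 1) → ℝ) i • v i = q + t0 • v 0 := by
        rw [Fin.sum_univ_succ, hq]
        simp only [Fin.cons_zero, Fin.cons_succ, Fin.tail]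
        abel
      simp only
      rw [h5, Fin.prod_univ_succ, LineDeriv.iteratedLineDerivOp_succ_left]
      simp only [Fin.cons_zero, Fin.cons_succ, Fin.tail]
      ring
    simp only [hin, integral_neg]
    rw [ih hvt, Fin.sum_univ_succ, pow_succ]
    simp only [Fin.tail, add_assoc]
    ring

/-! ### The extremal function: the tent and its mixed primitive. -/

section Extremal

variable {d : ℕ}

/-- The cone-shaped bump `x ↦ (h - ‖x‖)₊`. -/
def tent (h : ℝ) (x : Fin d → ℝ) : ℝ := max (h - ‖x‖) 0

theorem lipschitzWith_tent (h : ℝ) : LipschitzWith 1 (tent h : (Fin d → ℝ) → ℝ) := by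
  have h1 : LipschitzWith 1 fun x : Fin d → ℝ => h - ‖x‖ := by
    simpa using (LipschitzWith.const h).sub (lipschitzWith_one_norm (E := Fin d → ℝ))
  exact h1.max_const 0

theorem tent_nonneg (h : ℝ) (x : Fin d → ℝ) : 0 ≤ tent h x := le_max_right _ _

theorem abs_tent_le {h : ℝ} (hh : 0 ≤ h) (x : Fin d → ℝ) : |tent h x| ≤ h := by
  rw [abs_of_nonneg (tent_nonneg h x)]
  exact max_le (by linarith [norm_nonneg x]) hh

theorem integrable_tent (h : ℝ) : Integrable (tent h : (Fin d → ℝ) → ℝ) := by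
  refine (lipschitzWith_tent h).continuous.integrable_of_hasCompactSupport ?_
  refine HasCompactSupport.intro (isCompact_closedBall (0 : Fin d → ℝ) h) fun x hx => ?_
  have : h < ‖x‖ := by simpa using hx
  exact max_eq_right (by linarith)

theorem memLinf_tent (Ω : Opens (Fin d → ℝ)) {h : ℝ} (hh : 0 ≤ h) :
    MemLinf Ω (tent h) :=
  memLp_top_of_bound (lipschitzWith_tent h).continuous.aestronglyMeasurable h
    (Filter.Eventually.of_forall fun x => abs_tent_le hh x)

theorem hasWeakPartial_of_lipschitzWith {Ω : Opens (Fin d → ℝ)} {g : (Fin d → ℝ) → ℝ}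
    {C : NNReal} (hg : LipschitzWith C g) (i : Fin d) :
    HasWeakPartial Ω i g (fun x => lineDeriv ℝ g x (basisVec i)) ∧
      MemLinf Ω (fun x => lineDeriv ℝ g x (basisVec i)) := by
  have hm : MemLinf Ω (fun x => lineDeriv ℝ g x (basisVec i)) :=
    memLp_top_of_bound (measurable_lineDeriv hg.continuous).aestronglyMeasurable
      (C * ‖(basisVec i : Fin d → ℝ)‖)
      (Filter.Eventually.of_forall fun x => norm_lineDeriv_le_of_lipschitz ℝ hg)
  refine ⟨⟨hg.continuous.locallyIntegrable.locallyIntegrableOn _, hm.locallyIntegrableOn,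
    fun φ => ?_⟩, hm⟩
  have hr : ∀ (ψ : 𝓓(Ω, ℝ)) (u : (Fin d → ℝ) → ℝ),
      ∫ x, u x * ψ x ∂(leb Ω) = ∫ x, u x * ψ x := fun ψ u =>
    setIntegral_eq_integral_of_forall_compl_eq_zero fun x hx => by
      rw [image_eq_zero_of_notMem_tsupport fun hx' => hx (ψ.tsupport_subset hx'), mul_zero]
  obtain ⟨D, hD⟩ : ∃ D, LipschitzWith D φ :=
    ContDiff.lipschitzWith_of_hasCompactSupport φ.hasCompactSupport φ.contDiff (by simp)
  rw [hr, hr, hg.integral_lineDeriv_mul_eq hD φ.hasCompactSupport, ← integral_neg]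
  refine integral_congr_ae (Filter.Eventually.of_forall fun x => ?_)
  simp only
  rw [lineDerivOp_testFunction_apply,
    (φ.contDiff.differentiable (by simp)).differentiableAt.lineDeriv_eq_fderiv, map_neg]
  ring

theorem ae_sum_abs_lineDeriv_le {g : (Fin d → ℝ) → ℝ} {C : NNReal} (hg : LipschitzWith C g) :
    ∀ᵐ x, ∑ i, |lineDeriv ℝ g x (basisVec i)| ≤ C := by
  filter_upwards [hg.ae_differentiableAt (μ := volume)] with x hx
  set L := fderiv ℝ g x with hL
  -- The sign vector has sup norm at most 1 and recovers the ℓ¹ norm of the gradient as L s, which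
  -- the operator norm bounds by C.
  set s : Fin d → ℝ := fun i => SignType.sign (L (basisVec i)) with hs
  have h1 : ∑ i, |lineDeriv ℝ g x (basisVec i)| = L s := by
    have h2 : s = ∑ i, s i • basisVec i := by simpa [basisVec] using pi_eq_sum_univ' s
    rw [h2, map_sum]
    refine Finset.sum_congr rfl fun i _ => ?_
    rw [hx.lineDeriv_eq_fderiv, map_smul, smul_eq_mul, hs, sign_mul_self]
  have h3 : ‖s‖ ≤ 1 := (pi_norm_le_iff_of_nonneg zero_le_one).2 fun i => by
    rcases lt_trichotomy (L (basisVec i)) 0 with h | h | h <;> simp [hs, h]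
  rw [h1]
  calc L s ≤ ‖L s‖ := le_abs_self _
    _ ≤ ‖L‖ * ‖s‖ := L.le_opNorm s
    _ ≤ C * 1 := mul_le_mul (norm_fderiv_le_of_lipschitz ℝ hg) h3 (norm_nonneg _) C.2
    _ = C := mul_one _

/-- A primitive of `g` on `Ω` for the mixed derivative `∂ᵈ/∂x₁…∂x_d`, symmetric at infinity. -/
def mixedPrimitive (Ω : Opens (Fin d → ℝ)) (g : (Fin d → ℝ) → ℝ) (x : Fin d → ℝ) : ℝ :=
  ∫ y, g y * ∏ i, halfSign (y i) (x i) ∂(leb Ω)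

/-- The kernel has constant modulus 2^(-d); a one-sided primitive would lose this factor, which
equality requires. -/
theorem abs_mixedPrimitive_le {Ω : Opens (Fin d → ℝ)} {g : (Fin d → ℝ) → ℝ}
    (hg : Integrable g (leb Ω)) (x : Fin d → ℝ) :
    |mixedPrimitive Ω g x| ≤ (1 / 2) ^ d * ∫ y, |g y| ∂(leb Ω) := by
  rw [← integral_const_mul, ← Real.norm_eq_abs]
  refine norm_integral_le_of_norm_le (hg.abs.const_mul _)
    (Filter.Eventually.of_forall fun y => ?_)
  rw [norm_mul, Real.norm_eq_abs, Real.norm_eq_abs, abs_prod_halfSign, mul_comm]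

theorem integrable_mul_prod_halfSign_mul {μ ν : Measure (Fin d → ℝ)} [SFinite μ] [SFinite ν]
    {u w : (Fin d → ℝ) → ℝ} (hu : Integrable u μ) (hw : Integrable w ν) :
    Integrable (fun p : (Fin d → ℝ) × (Fin d → ℝ) =>
      w p.2 * (∏ i, halfSign (p.2 i) (p.1 i)) * u p.1) (μ.prod ν) := by
  have h1 := (hu.mul_prod hw).bdd_mul
    ((measurable_prod_halfSign d).comp measurable_swap).aestronglyMeasurable
    (Filter.Eventually.of_forall fun p => (abs_prod_halfSign p.2 p.1).le)
  refine h1.congr (Filter.Eventually.of_forall fun p => ?_)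
  simp only [Function.comp, Prod.fst_swap, Prod.snd_swap]
  ring

theorem memLinf_mixedPrimitive {Ω : Opens (Fin d → ℝ)} {g : (Fin d → ℝ) → ℝ}
    (hgm : Measurable g) (hg : Integrable g (leb Ω)) : MemLinf Ω (mixedPrimitive Ω g) := by
  refine memLp_top_of_bound ?_ _
    (Filter.Eventually.of_forall fun x => abs_mixedPrimitive_le hg x)
  have : SFinite (leb Ω) := by unfold leb; infer_instance
  refine (StronglyMeasurable.integral_prod_right'
    (f := fun p : (Fin d → ℝ) × (Fin d → ℝ) => g p.2 * ∏ i, halfSign (p.2 i) (p.1 i)) ?_).aestronglyMeasurable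
  exact ((hgm.comp measurable_snd).mul
    ((measurable_prod_halfSign d).comp measurable_swap)).stronglyMeasurable

theorem linearIndependent_basisVec : LinearIndependent ℝ (fun i : Fin d => basisVec i) := by
  have := (Pi.basisFun ℝ (Fin d)).linearIndependent
  convert this using 1
  ext i
  simp [basisVec]

/-- Exchange the integrals by Fubini; the inner one then pairs the kernel with the mixed derivative
of φ and returns (-1)^d φ(y). -/
theorem hasWeakMixed_mixedPrimitive {Ω : Opens (Fin d → ℝ)} {g : (Fin d → ℝ) → ℝ}
    (hgm : Measurable g) (hg : Integrable g (leb Ω))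
    (hgl : LocallyIntegrableOn g (Ω : Set (Fin d → ℝ))) :
    HasWeakMixed Ω (mixedPrimitive Ω g) g := by
  refine ⟨(memLinf_mixedPrimitive hgm hg).locallyIntegrableOn, hgl, fun φ => ?_⟩
  have : SFinite (leb Ω) := by unfold leb; infer_instance
  set ψ := (∂^{fun i : Fin d => basisVec i} φ) with hψ
  have hψi : Integrable ψ (leb Ω) :=
    (ψ.continuous.integrable_of_hasCompactSupport ψ.hasCompactSupport).restrict
  simp only [mixedPrimitive, ← integral_mul_const]
  rw [integral_integral_swap (integrable_mul_prod_halfSign_mul hψi hg), ← integral_const_mul]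
  refine integral_congr_ae (Filter.Eventually.of_forall fun y => ?_)
  have h1 := integral_prod_halfSign_mul_iteratedLineDerivOp
    (linearIndependent_basisVec (d := d)) φ 0 y
  have h2 : ∀ t : Fin d → ℝ, (0 : Fin d → ℝ) + ∑ i, t i • basisVec i = t := fun t => by
    simpa [basisVec] using (pi_eq_sum_univ' t).symm
  simp only [h2] at h1
  simp only [mul_assoc]
  rw [integral_const_mul, leb, setIntegral_eq_integral_of_forall_compl_eq_zero, h1]
  · ring
  · intro x hx
    rw [image_eq_zero_of_notMem_tsupport fun hx' => hx (ψ.tsupport_subset hx'), mul_zero]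

end Extremal

theorem integral_tent_le {d m : ℕ} (hd : 1 ≤ d) (hm : m ≤ d) {h : ℝ} (hh : 0 ≤ h) :
    ∫ y, |tent h y| ∂(leb (cone d m)) ≤ 2 ^ (d - m) * h ^ (d + 1) / (d + 1) := by
  rw [← integral_coneBox_sub_norm hd hm hh]
  have hQm : MeasurableSet (coneBox d m h) := measurableSet_Icc
  have hint : IntegrableOn (fun y : Fin d → ℝ => h - ‖y‖) (coneBox d m h) :=
    (continuous_const.sub continuous_norm).continuousOn.integrableOn_compact isCompact_Icc
  rw [← integral_indicator hQm]
  have h1 : ∫ y, |tent h y| ∂(leb (cone d m)) =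
      ∫ y in (cone d m : Set (Fin d → ℝ)), (coneBox d m h).indicator (fun y => h - ‖y‖) y := by
    refine setIntegral_congr_fun (cone d m).isOpen.measurableSet fun y hy => ?_
    simp only [abs_of_nonneg (tent_nonneg h y)]
    by_cases hyh : ‖y‖ ≤ h
    · rw [Set.indicator_of_mem ((mem_coneBox hd).2 ⟨fun i hi => (hy i hi).le, hyh⟩)]
      exact max_eq_left (by linarith)
    · rw [Set.indicator_of_notMem fun hy' => hyh ((mem_coneBox hd).1 hy').2]
      exact max_eq_right (by linarith)
  rw [h1]
  refine setIntegral_le_integral (hint.integrable_indicator hQm)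
    (Filter.Eventually.of_forall fun y => ?_)
  refine Set.indicator_nonneg (fun y hy => ?_) y
  exact sub_nonneg.2 ((mem_coneBox hd).1 hy).2

theorem le_normLinf_of_ae_eq_tent {d m : ℕ} {h : ℝ} {u : (Fin d → ℝ) → ℝ}
    (hu : MemLinf (cone d m) u) (hut : u =ᵐ[leb (cone d m)] tent h) :
    h ≤ normLinf (cone d m) u := by
  by_contra! hlt
  set A := normLinf (cone d m) u
  -- The peak 0 lies outside the open cone when m > 0, so use the diagonal point (δ, …, δ), where
  -- the tent is at least h - δ > A; by continuity this persists on an open set.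
  set δ := (h - A) / 2 with hδ
  have hδ0 : 0 < δ := by rw [hδ]; linarith
  have hopen : IsOpen ((cone d m : Set (Fin d → ℝ)) ∩ {x | A < tent h x}) :=
    (cone d m).isOpen.inter (isOpen_lt continuous_const (lipschitzWith_tent h).continuous)
  have hne : ((cone d m : Set (Fin d → ℝ)) ∩ {x | A < tent h x}).Nonempty := by
    refine ⟨fun _ => δ, fun i _ => hδ0, ?_⟩
    have h1 : ‖(fun _ => δ : Fin d → ℝ)‖ ≤ δ :=
      (pi_norm_le_iff_of_nonneg hδ0.le).2 fun i => by simp [abs_of_pos hδ0]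
    have h2 : A < h - ‖(fun _ => δ : Fin d → ℝ)‖ := by
      have h3 : 2 * δ = h - A := by rw [hδ]; ring
      linarith
    exact lt_max_of_lt_left h2
  have hpos := hopen.measure_pos volume hne
  have hae : ∀ᵐ x ∂(leb (cone d m)), tent h x ≤ A := by
    filter_upwards [hu.ae_abs_le, hut] with x h1 h2
    rw [← h2]
    exact (le_abs_self _).trans h1
  rw [leb, ae_restrict_iff' (cone d m).isOpen.measurableSet, ae_iff] at hae
  refine hpos.ne' ?_
  rw [← hae]
  congr 1
  ext x
  simp

theorem exists_extremal {d m : ℕ} (hd : 1 ≤ d) (hm : m ≤ d) {h : ℝ} (hh : 0 < h) :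
    ∃ f : (Fin d → ℝ) → ℝ, MemMixed (cone d m) f ∧
      h ≤ normLinf (cone d m) (weakMixed (cone d m) f) ∧
      normLinf (cone d m) (gradNormOne (cone d m) (weakMixed (cone d m) f)) ≤ 1 ∧
      normLinf (cone d m) f ≤ h ^ (d + 1) / (2 ^ m * (d + 1)) := by
  have htc := (lipschitzWith_tent (d := d) h).continuous
  have hti : Integrable (tent h) (leb (cone d m)) := (integrable_tent h).restrict
  have htm := memLinf_tent (cone d m) hh.le
  have hmix := hasWeakMixed_mixedPrimitive htc.measurable hti htm.locallyIntegrableOn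
  have hpart := fun i => hasWeakPartial_of_lipschitzWith (Ω := cone d m)
    (lipschitzWith_tent (d := d) h) i
  have hmem : MemMixed (cone d m) (mixedPrimitive (cone d m) (tent h)) :=
    ⟨memLinf_mixedPrimitive htc.measurable hti, tent h, hmix, htm, fun i => ⟨_, hpart i⟩⟩
  refine ⟨_, hmem, le_normLinf_of_ae_eq_tent (memLinf_weakMixed hmem)
    (hmix.weakMixed.ae_eq hmix), normLinf_le zero_le_one ?_, normLinf_le (by positivity) ?_⟩
  · filter_upwards [gradNormOne_weakMixed_ae_eq hmix fun i => (hpart i).1,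
      ae_restrict_of_ae (ae_sum_abs_lineDeriv_le (lipschitzWith_tent (d := d) h))] with x h1 h2
    rw [h1, abs_of_nonneg (Finset.sum_nonneg fun i _ => abs_nonneg _)]
    simpa using h2
  · refine Filter.Eventually.of_forall fun x => ?_
    refine (abs_mixedPrimitive_le hti x).trans ?_
    refine (mul_le_mul_of_nonneg_left (integral_tent_le hd hm hh.le) (by positivity)).trans_eq ?_
    -- The kernel's 2^(-d) times the factor 2^(d-m) from the integral of the tent leaves 2^(-m).
    have hpow : (2 : ℝ) ^ d = 2 ^ (d - m) * 2 ^ m := by rw [← pow_add, Nat.sub_add_cancel hm]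
    rw [one_div, inv_pow, hpow]
    field_simp

/-- The bounds of `exists_extremal` put each right-hand side below h and the left-hand side above h,
so the proved inequalities close up to equalities. -/
theorem exists_eq_add_and_eq_mul {d m : ℕ} (hd : 1 ≤ d) (hm : m ≤ d) {h : ℝ} (hh : 0 < h) :
    ∃ f : (Fin d → ℝ) → ℝ, MemMixed (cone d m) f ∧
      0 < normLinf (cone d m) (weakMixed (cone d m) f) ∧
      normLinf (cone d m) (weakMixed (cone d m) f) =
        h * ((d : ℝ) / (d + 1)) * normLinf (cone d m) (gradNormOne (cone d m)
          (weakMixed (cone d m) f)) + 2 ^ m / h ^ d * normLinf (cone d m) f ∧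
      normLinf (cone d m) (weakMixed (cone d m) f) =
        (2 ^ m * ((d : ℝ) + 1) * normLinf (cone d m) f) ^ ((1 : ℝ) / (d + 1)) *
          normLinf (cone d m) (gradNormOne (cone d m) (weakMixed (cone d m) f))
            ^ ((d : ℝ) / (d + 1)) := by
  obtain ⟨f, hf, hA, hΓ, hF⟩ := exists_extremal hd hm hh
  have hadd := normLinf_weakMixed_le_add hd hm hf hh
  have hmul := normLinf_weakMixed_le_mul hd hm hf
  have hF0 := normLinf_nonneg (Ω := cone d m) f
  have hΓ0 := normLinf_nonneg (Ω := cone d m) (gradNormOne (cone d m) (weakMixed (cone d m) f))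
  have hd1 : (0 : ℝ) < (d : ℝ) + 1 := by positivity
  refine ⟨f, hf, hh.trans_le hA, le_antisymm hadd (le_trans ?_ hA),
    le_antisymm hmul (le_trans ?_ hA)⟩
  · calc _ ≤ h * ((d : ℝ) / (d + 1)) * 1 + 2 ^ m / h ^ d * (h ^ (d + 1) / (2 ^ m * (d + 1))) := by
          gcongr
      _ = h := by
          field_simp
          ring
  · have h1 : 2 ^ m * ((d : ℝ) + 1) * normLinf (cone d m) f ≤ h ^ (d + 1) := by
      calc _ ≤ 2 ^ m * ((d : ℝ) + 1) * (h ^ (d + 1) / (2 ^ m * (d + 1))) := by gcongr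
        _ = h ^ (d + 1) := by field_simp
    calc _ ≤ (h ^ (d + 1)) ^ ((1 : ℝ) / (d + 1)) * 1 :=
          mul_le_mul (Real.rpow_le_rpow (by positivity) h1 (by positivity))
            (Real.rpow_le_one hΓ0 hΓ (by positivity)) (by positivity) (by positivity)
      _ = h := by
          rw [mul_one, ← Real.rpow_natCast, ← Real.rpow_mul hh.le]
          push_cast
          rw [mul_one_div_cancel hd1.ne', Real.rpow_one]

end MixedDeriv

end

theorem theorem5 (d m : ℕ) (hd : 1 ≤ d) (hm : m ≤ d) :
    -- the inequalities
    (∀ f : (Fin d → ℝ) → ℝ, MixedDeriv.MemMixed (MixedDeriv.cone d m) f →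
      MixedDeriv.MemLinf (MixedDeriv.cone d m)
          (MixedDeriv.weakMixed (MixedDeriv.cone d m) f) ∧
      MixedDeriv.MemLinf (MixedDeriv.cone d m)
          (MixedDeriv.gradNormOne (MixedDeriv.cone d m)
            (MixedDeriv.weakMixed (MixedDeriv.cone d m) f)) ∧
      (∀ h : ℝ, 0 < h →
        MixedDeriv.normLinf (MixedDeriv.cone d m)
            (MixedDeriv.weakMixed (MixedDeriv.cone d m) f)
          ≤ h * ((d : ℝ) / ((d : ℝ) + 1)) *
              MixedDeriv.normLinf (MixedDeriv.cone d m)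
                (MixedDeriv.gradNormOne (MixedDeriv.cone d m)
                  (MixedDeriv.weakMixed (MixedDeriv.cone d m) f))
            + (2 : ℝ) ^ m / h ^ d * MixedDeriv.normLinf (MixedDeriv.cone d m) f) ∧
      MixedDeriv.normLinf (MixedDeriv.cone d m)
          (MixedDeriv.weakMixed (MixedDeriv.cone d m) f)
        ≤ ((2 : ℝ) ^ m * ((d : ℝ) + 1) * MixedDeriv.normLinf (MixedDeriv.cone d m) f)
              ^ ((1 : ℝ) / ((d : ℝ) + 1)) *
            MixedDeriv.normLinf (MixedDeriv.cone d m)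
              (MixedDeriv.gradNormOne (MixedDeriv.cone d m)
                (MixedDeriv.weakMixed (MixedDeriv.cone d m) f))
              ^ ((d : ℝ) / ((d : ℝ) + 1))) ∧
    -- sharpness for `m = 0` and `m = 1`: equality for functions with nonzero mixed derivative
    (m = 0 ∨ m = 1 →
      ∀ h : ℝ, 0 < h → ∃ f : (Fin d → ℝ) → ℝ,
        MixedDeriv.MemMixed (MixedDeriv.cone d m) f ∧
        0 < MixedDeriv.normLinf (MixedDeriv.cone d m)
              (MixedDeriv.weakMixed (MixedDeriv.cone d m) f) ∧
        MixedDeriv.normLinf (MixedDeriv.cone d m)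
            (MixedDeriv.weakMixed (MixedDeriv.cone d m) f)
          = h * ((d : ℝ) / ((d : ℝ) + 1)) *
              MixedDeriv.normLinf (MixedDeriv.cone d m)
                (MixedDeriv.gradNormOne (MixedDeriv.cone d m)
                  (MixedDeriv.weakMixed (MixedDeriv.cone d m) f))
            + (2 : ℝ) ^ m / h ^ d * MixedDeriv.normLinf (MixedDeriv.cone d m) f ∧
        MixedDeriv.normLinf (MixedDeriv.cone d m)
            (MixedDeriv.weakMixed (MixedDeriv.cone d m) f)
          = ((2 : ℝ) ^ m * ((d : ℝ) + 1) * MixedDeriv.normLinf (MixedDeriv.cone d m) f)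
                ^ ((1 : ℝ) / ((d : ℝ) + 1)) *
              MixedDeriv.normLinf (MixedDeriv.cone d m)
                (MixedDeriv.gradNormOne (MixedDeriv.cone d m)
                  (MixedDeriv.weakMixed (MixedDeriv.cone d m) f))
                ^ ((d : ℝ) / ((d : ℝ) + 1))) := by
  refine ⟨fun f hf => ⟨MixedDeriv.memLinf_weakMixed hf,
    MixedDeriv.memLinf_gradNormOne_weakMixed hf,
    fun h hh => MixedDeriv.normLinf_weakMixed_le_add hd hm hf hh,
    MixedDeriv.normLinf_weakMixed_le_mul hd hm hf⟩, fun _ h hh =>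
    MixedDeriv.exists_eq_add_and_eq_mul hd hm hh⟩
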